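/- A puzzle piece is a unit equilateral triangle whose three edges are labeled by elements of $\{0,1,10\}$. Let $\mathfrak H$ be the set consisting of the upward-pointing triangle with all edges labeled $0$, the upward-pointing triangle with all edges labeled $1$, the upward-pointing triangle whose NW, NE and South edges are labeled $1$, $0$ and $10$ respectively, and all rotations of these three pieces by multiples of $60^\circ$. Let $a,a_1,c,c_1$ be non-negative integers. Write $\binom{[n]}{k}$ for the set of binary strings of length $n$ with exactly $k$ ones. For $\alpha,\beta\in\binom{[a]}{a_1}$ and $\gamma,\delta\in\binom{[c]}{c_1}$, consider the lattice parallelogram with SW and NE sides of length $a$ and with NW and SE sides of length $c$ (the SW and NE sides at angle $120^\circ$ and the NW and SE sides at angle $60^\circ$ to the $x$-axis), with its SW, NW, NE and SE sides labeled, edge by edge, by $\alpha,\gamma,\beta,\delta$, each string being read clockwise along the boundary. Let $N(\alpha,\gamma,\beta,\delta)$ be the number of puzzles with this boundary, i.e. of tilings of the parallelogram by pieces of $\mathfrak H$ such that any two glued edges have the same label and the labels along the boundary are the prescribed ones. (If $a=0$ or $c=0$ the parallelogram is a segment without pieces, and a puzzle is a labeling of its unit edges that agrees with the prescribed strings from both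 sides.) Then, for all $\alpha,\beta\in\binom{[a]}{a_1}$ and $\gamma,\delta\in\binom{[c]}{c_1}$, $$N(\alpha,\gamma,\beta,\delta)=N(\beta,\gamma,\alpha,\delta)=N(\alpha,\delta,\beta,\gamma)=N(\beta,\delta,\alpha,\gamma).$$ In other words, the pairs $\alpha,\beta$ and $\gamma,\delta$ can be swapped independently, and each swap preserves the number of puzzles. -/

import Mathlib

namespace Puzzle

/-- The labels that an edge of a puzzle piece can carry: `0`, `1` and `10`. -/
inductive Label where
  | zero
  | one
  | ten
  deriving DecidableEq

instance : Fintype Label :=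
  ⟨{.zero, .one, .ten}, fun x => by cases x <;> decide⟩

/-- A unit triangle with labeled edges. An upward-pointing triangle has a NW, a NE and a South edge;
a downward-pointing triangle has a North, a SE and a SW edge. Both are listed clockwise. -/
inductive Piece where
  | up (nw ne s : Label)
  | down (n se sw : Label)
  deriving DecidableEq

/-- Clockwise rotation of a piece by 60 degrees. An upward-pointing triangle becomes a
downward-pointing one (NW goes to North, NE to SE, South to SW) and conversely (North goes to NE,
SE to South, SW to NW). -/
def Piece.rotate : Piece → Piece
  | .up nw ne s => .down nw ne s
  | .down n se sw => .up sw n se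

/-- The three upward-pointing pieces, with edges listed in the order NW, NE, South, of which all
other pieces are rotations. -/
def basePieces : Set Piece :=
  {.up .zero .zero .zero, .up .one .one .one, .up .one .zero .ten}

/-- The set of ordinary puzzle pieces: the base pieces and all their rotations in 60 degree
increments. -/
def H : Set Piece :=
  {P | ∃ B ∈ basePieces, ∃ k : ℕ, P = Piece.rotate^[k] B}

/-- Binary strings of length `n` with exactly `k` ones (and hence `n - k` zeros). -/
def BinString (n k : ℕ) : Type :=
  {s : Fin n → Fin 2 // (Finset.univ.filter fun i => s i = 1).card = k}

/-- The label of the `i`-th boundary edge prescribed by a binary string. -/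
def BinString.label {n k : ℕ} (s : BinString n k) (i : Fin n) : Label :=
  if s.1 i = 1 then .one else .zero

/-- A puzzle (with pieces in `H`) filling the parallelogram whose SW and NE sides have length `a`,
whose NW and SE sides have length `c`, and whose SW, NW, NE and SE sides carry the strings
`α`, `γ`, `β`, `δ`, all read clockwise along the boundary.

The lattice points of the parallelogram are `P i j` with `0 ≤ i ≤ c` and `0 ≤ j ≤ a`. The point
`P 0 0` is the bottom corner, `P (i+1) j` is one unit from `P i j` in the direction of angle
60 degrees, and `P i (j+1)` is one unit from `P i j` in the direction of angle 120 degrees. The unit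
edges are

* `rising i j`, the edge from `P i j` to `P (i+1) j`;
* `falling i j`, the edge from `P i j` to `P i (j+1)`;
* `horizontal i j`, the edge from `P i (j+1)` to `P (i+1) j`.

The unit triangles are, for `i < c` and `j < a`, the upward-pointing one with vertices `P i (j+1)`,
`P (i+1) (j+1)`, `P (i+1) j`, and the downward-pointing one with vertices `P i j`, `P i (j+1)`,
`P (i+1) j`. A filling is a labeling of the edges for which each of these triangles is a piece
in `H` (labels on glued edges then agree, since each edge has one label). -/
@[ext]
structure ParPuzzle {a a₁ c c₁ : ℕ} (α : BinString a a₁) (γ : BinString c c₁)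
    (β : BinString a a₁) (δ : BinString c c₁) where
  rising : Fin c → Fin (a + 1) → Label
  falling : Fin (c + 1) → Fin a → Label
  horizontal : Fin c → Fin a → Label
  up_mem : ∀ (i : Fin c) (j : Fin a),
    Piece.up (rising i j.succ) (falling i.succ j) (horizontal i j) ∈ H
  down_mem : ∀ (i : Fin c) (j : Fin a),
    Piece.down (horizontal i j) (rising i j.castSucc) (falling i.castSucc j) ∈ H
  /-- the SW side, read from the bottom corner to the left corner -/
  sw : ∀ j : Fin a, falling 0 j = α.label j
  /-- the NW side, read from the left corner to the top corner -/
  nw : ∀ i : Fin c, rising i (Fin.last a) = γ.label i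
  /-- the NE side, read from the top corner to the right corner -/
  ne : ∀ j : Fin a, falling (Fin.last c) j.rev = β.label j
  /-- the SE side, read from the right corner to the bottom corner -/
  se : ∀ i : Fin c, rising i.rev 0 = δ.label i

/-- There are only finitely many puzzles with a given boundary. -/
instance ParPuzzle.finite {a a₁ c c₁ : ℕ} (α : BinString a a₁) (γ : BinString c c₁)
    (β : BinString a a₁) (δ : BinString c c₁) : Finite (ParPuzzle α γ β δ) :=
  Finite.of_injective
    (fun P : ParPuzzle α γ β δ => (P.rising, P.falling, P.horizontal))
    (fun P Q h => by
      simp only [Prod.mk.injEq] at h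
      exact ParPuzzle.ext h.1 h.2.1 h.2.2)

/-- The number of puzzles with the given parallelogram-shaped boundary. -/
noncomputable def numPuzzles {a a₁ c c₁ : ℕ} (α : BinString a a₁) (γ : BinString c c₁)
    (β : BinString a a₁) (δ : BinString c c₁) : ℕ :=
  Nat.card (ParPuzzle α γ β δ)

end Puzzle

/-!
A puzzle on a parallelogram is a configuration of a vertex model: gluing the upward and the
downward triangle that share a horizontal edge gives a rhombus, whose horizontal label is
determined by the other four, so a puzzle is a labeling of the rising and the falling edges in
which every unit rhombus is admissible, and the number of puzzles is a partition function
(`partitionSum`, `numPuzzles_eq_partitionSum`). Rotation by 180 degrees exchanges both pairs of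
strings at once (`numPuzzles_rotate`), so it is enough to swap `γ` and `δ` (`numPuzzles_swap`).

The rhombus weights belong to a one-parameter family `rhombusWeight u`, with `u = 0` counting
puzzles, which satisfies the Yang-Baxter equation (`yangBaxter`) with the line crossing
`crossWeight`. Hence an extra line of parameter `u`, parallel to the strands that join the `δ`
side to the `γ` side, can be swept through the whole parallelogram (`sweep`). If both ends of that
line carry the label `1`, it crosses the strands of `α` and of `β` without any effect, while its
crossing with the strands of `γ` and `δ` is an operator `pieri u` on binary strings, a generating
function of Pieri operators: the ones of a string move like the addition of a horizontal strip to
a partition. So the bilinear form `F` on binary strings of length `c` given by the number of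
puzzles, for `α` and `β` fixed, has the property that every Pieri operator is self-adjoint for `F`
(`pieriSelfAdjoint_partitionSum`).

The Pieri operators commute with each other, again by a Yang-Baxter equation
(`pieriMatrix_mul_comm`), and they generate every string from a sorted one: for each string `d`
that is not sorted there are a smaller string `v` and a Pieri operator whose value on `v` has `d`
as its leading term (`antitone_or_exists_leading`). With `v₀` the sorted string and `p`, `q`
polynomials in the Pieri operators, `F (p v₀) (q v₀) = F v₀ (p q v₀) = F v₀ (q p v₀) =
F (q v₀) (p v₀)`, that is, a form for which all Pieri operators are self-adjoint is symmetric
(`PieriSelfAdjoint.apply_comm`).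
-/

namespace Puzzle

/-! ### Row transfer weights -/

section Transfer

variable {R : Type*} [CommRing R] {A B S : Type*}

/-- The transfer matrix of a vertex model with weights `L a s a' s'`, where a line enters a site
with label `a` and leaves it with label `a'`, changing the label of the site from `s` to `s'`. It is
the total weight of a line that enters with label `a`, leaves with label `a'` and passes the sites
in increasing order, changing the word `w` to `w'`. -/
def transfer [Fintype A] [DecidableEq A] (L : A → S → A → S → R) :
    (n : ℕ) → A → (Fin n → S) → A → (Fin n → S) → R
  | 0, a, _, a', _ => if a = a' then 1 else 0
  | n + 1, a, w, a', w' =>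
      ∑ x, L a (w 0) x (w' 0) * transfer L n x (Fin.tail w) a' (Fin.tail w')

theorem sum_word_succ {M : Type*} [AddCommMonoid M] [Fintype S] (n : ℕ)
    (f : (Fin (n + 1) → S) → M) :
    ∑ w, f w = ∑ s : S, ∑ w : Fin n → S, f (Fin.cons s w) := by
  rw [← Fintype.sum_prod_type']
  exact (Fintype.sum_equiv (Fin.consEquiv fun _ => S) _ _ fun _ => rfl).symm

variable [Fintype A] [DecidableEq A]

theorem transfer_zero (L : A → S → A → S → R) (a a' : A) (w w' : Fin 0 → S) :
    transfer L 0 a w a' w' = if a = a' then 1 else 0 := rfl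

theorem transfer_succ (L : A → S → A → S → R) (n : ℕ) (a a' : A) (w w' : Fin (n + 1) → S) :
    transfer L (n + 1) a w a' w' =
      ∑ x, L a (w 0) x (w' 0) * transfer L n x (Fin.tail w) a' (Fin.tail w') := rfl

theorem transfer_map {R' : Type*} [CommRing R'] (φ : R →+* R') (L : A → S → A → S → R) (n : ℕ)
    (a a' : A) (w w' : Fin n → S) :
    transfer (fun a s a' s' => φ (L a s a' s')) n a w a' w' = φ (transfer L n a w a' w') := by
  induction n generalizing a with
  | zero => simp [transfer_zero, apply_ite φ]
  | succ n ih => simp [transfer_succ, ih]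

theorem transfer_eq_sum_path (L : A → S → A → S → R) (n : ℕ) (a a' : A) (w w' : Fin n → S) :
    transfer L n a w a' w' =
      ∑ p : Fin (n + 1) → A, if p 0 = a ∧ p (Fin.last n) = a' then
        ∏ j, L (p j.castSucc) (w j) (p j.succ) (w' j) else 0 := by
  induction n generalizing a with
  | zero =>
    rw [transfer_zero, sum_word_succ, Finset.sum_eq_single a]
    · simp
    · intro b _ hb
      simp [hb]
    · simp
  | succ n ih =>
    rw [sum_word_succ, Finset.sum_eq_single a, transfer_succ]
    · simp only [ih, Finset.mul_sum]
      rw [Finset.sum_comm]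
      refine Finset.sum_congr rfl fun p _ => ?_
      rw [Finset.sum_eq_single (p 0)]
      · simp [Fin.prod_univ_succ, ← Fin.succ_last, Fin.tail, ← Fin.succ_castSucc,
          -Fin.castSucc_succ]
      · intro b _ hb
        simp [hb.symm]
      · simp
    · intro b _ hb
      simp [hb]
    · simp

/-- Traversing a line backwards reverses the words and exchanges incoming and outgoing labels. -/
theorem transfer_rev (L : A → S → A → S → R) (n : ℕ) (a a' : A) (w w' : Fin n → S) :
    transfer L n a (w ∘ Fin.rev) a' (w' ∘ Fin.rev) =
      transfer (fun a s a' s' => L a' s' a s) n a' w' a w := by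
  rw [transfer_eq_sum_path, transfer_eq_sum_path]
  refine Fintype.sum_equiv (Equiv.arrowCongr Fin.revPerm (Equiv.refl A)) _ _ fun p => ?_
  have h : (∏ j, L (p j.castSucc) ((w ∘ Fin.rev) j) (p j.succ) ((w' ∘ Fin.rev) j)) =
      ∏ j : Fin n, L (p j.succ.rev) (w j) (p j.castSucc.rev) (w' j) := by
    refine Fintype.prod_equiv Fin.revPerm _ _ fun j => ?_
    simp [Fin.rev_succ, Fin.rev_castSucc]
  rw [h]
  simp [and_comm]

variable [Fintype B] [DecidableEq B] [Fintype S]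

/-- Moving a crossing `X` of two lines past one site (hypothesis `h`) implies moving it past a row
of `n` sites. -/
theorem transfer_intertwine (X : A → B → A → B → R) (L : A → S → A → S → R)
    (M : B → S → B → S → R)
    (h : ∀ a b s a₂ b₂ s₂,
      ∑ a₁, ∑ b₁, ∑ s₁, X a b a₁ b₁ * L a₁ s a₂ s₁ * M b₁ s₁ b₂ s₂ =
        ∑ a₁, ∑ b₁, ∑ s₁, M b s b₁ s₁ * L a s₁ a₁ s₂ * X a₁ b₁ a₂ b₂)
    (n : ℕ) (a a₂ : A) (b b₂ : B) (w w₂ : Fin n → S) :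
    ∑ a₁, ∑ b₁, ∑ w₁, X a b a₁ b₁ * transfer L n a₁ w a₂ w₁ * transfer M n b₁ w₁ b₂ w₂ =
      ∑ a₁, ∑ b₁, ∑ w₁, transfer M n b w b₁ w₁ * transfer L n a w₁ a₁ w₂ * X a₁ b₁ a₂ b₂ := by
  induction n generalizing a b with
  | zero => simp [transfer_zero]
  | succ n ih =>
    calc
      _ = ∑ x, ∑ y, ∑ w₁, (∑ a₁, ∑ b₁, ∑ s₁,
            X a b a₁ b₁ * L a₁ (w 0) x s₁ * M b₁ s₁ y (w₂ 0)) *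
            (transfer L n x (Fin.tail w) a₂ w₁ * transfer M n y w₁ b₂ (Fin.tail w₂)) := by
        simp only [sum_word_succ, transfer_succ, Finset.mul_sum, Finset.sum_mul, Fin.cons_zero,
          Fin.tail_cons]
        simp only [← Fintype.sum_prod_type']
        exact Fintype.sum_equiv
          ⟨fun ⟨a₁, b₁, s₁, w₁, y, x⟩ => ⟨x, y, w₁, a₁, b₁, s₁⟩,
            fun ⟨x, y, w₁, a₁, b₁, s₁⟩ => ⟨a₁, b₁, s₁, w₁, y, x⟩,
            fun _ => rfl, fun _ => rfl⟩ _ _ fun _ => by simp; ring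
      _ = ∑ a₁, ∑ b₁, ∑ s₁, M b (w 0) b₁ s₁ * L a s₁ a₁ (w₂ 0) * (∑ x, ∑ y, ∑ w₁,
            X a₁ b₁ x y * transfer L n x (Fin.tail w) a₂ w₁ *
              transfer M n y w₁ b₂ (Fin.tail w₂)) := by
        simp only [h]
        simp only [Finset.mul_sum, Finset.sum_mul, ← Fintype.sum_prod_type']
        exact Fintype.sum_equiv
          ⟨fun ⟨x, y, w₁, a₁, b₁, s₁⟩ => ⟨a₁, b₁, s₁, x, y, w₁⟩,
            fun ⟨a₁, b₁, s₁, x, y, w₁⟩ => ⟨x, y, w₁, a₁, b₁, s₁⟩,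
            fun _ => rfl, fun _ => rfl⟩ _ _ fun _ => by simp; ring
      _ = _ := by
        simp only [ih, sum_word_succ, transfer_succ, Finset.mul_sum, Finset.sum_mul, Fin.cons_zero,
          Fin.tail_cons]
        simp only [← Fintype.sum_prod_type']
        exact Fintype.sum_equiv
          ⟨fun ⟨a₁, b₁, s₁, x, y, w₁⟩ => ⟨x, y, s₁, w₁, a₁, b₁⟩,
            fun ⟨x, y, s₁, w₁, a₁, b₁⟩ => ⟨a₁, b₁, s₁, x, y, w₁⟩,
            fun _ => rfl, fun _ => rfl⟩ _ _ fun _ => by simp; ring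

/-- If a line `b` with weights `G` can be moved over one site together with its crossing `U` with a
line `a` with weights `Y` (hypothesis `h`), then it can be moved over a row of `n` sites. The line
`a` passes the sites in decreasing order, which is why the arguments of `Y` are exchanged. -/
theorem transfer_exchange (Y : A → S → A → S → R) (U : A → B → A → B → R)
    (G : B → S → B → S → R)
    (h : ∀ a b s a₂ b₂ s₂,
      ∑ a₁, ∑ s₁, ∑ b₁, Y a₁ s₁ a s * U a₁ b a₂ b₁ * G b₁ s₁ b₂ s₂ =
        ∑ a₁, ∑ s₁, ∑ b₁, G b s b₁ s₁ * U a b₁ a₁ b₂ * Y a₂ s₂ a₁ s₁)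
    (n : ℕ) (a a₂ : A) (b b₂ : B) (w w₂ : Fin n → S) :
    ∑ a₁, ∑ w₁, ∑ b₁, transfer Y n a₁ w₁ a w * U a₁ b a₂ b₁ * transfer G n b₁ w₁ b₂ w₂ =
      ∑ a₁, ∑ w₁, ∑ b₁, transfer G n b w b₁ w₁ * U a b₁ a₁ b₂ * transfer Y n a₂ w₂ a₁ w₁ := by
  induction n generalizing b a₂ with
  | zero => simp [transfer_zero]
  | succ n ih =>
    calc
      _ = ∑ x, ∑ y, ∑ w₁, (∑ a₁, ∑ s₁, ∑ b₁,
            Y a₁ s₁ x (w 0) * U a₁ b a₂ b₁ * G b₁ s₁ y (w₂ 0)) *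
            (transfer Y n x w₁ a (Fin.tail w) * transfer G n y w₁ b₂ (Fin.tail w₂)) := by
        simp only [sum_word_succ, transfer_succ, Finset.mul_sum, Finset.sum_mul, Fin.cons_zero,
          Fin.tail_cons]
        simp only [← Fintype.sum_prod_type']
        exact Fintype.sum_equiv
          ⟨fun ⟨a₁, s₁, w₁, b₁, y, x⟩ => ⟨x, y, w₁, a₁, s₁, b₁⟩,
            fun ⟨x, y, w₁, a₁, s₁, b₁⟩ => ⟨a₁, s₁, w₁, b₁, y, x⟩,
            fun _ => rfl, fun _ => rfl⟩ _ _ fun _ => by simp; ring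
      _ = ∑ a₁, ∑ s₁, ∑ b₁, G b (w 0) b₁ s₁ * Y a₂ (w₂ 0) a₁ s₁ * (∑ x, ∑ w₁, ∑ y,
            transfer Y n x w₁ a (Fin.tail w) * U x b₁ a₁ y *
              transfer G n y w₁ b₂ (Fin.tail w₂)) := by
        simp only [h]
        simp only [Finset.mul_sum, Finset.sum_mul, ← Fintype.sum_prod_type']
        exact Fintype.sum_equiv
          ⟨fun ⟨x, y, w₁, a₁, s₁, b₁⟩ => ⟨a₁, s₁, b₁, x, w₁, y⟩,
            fun ⟨a₁, s₁, b₁, x, w₁, y⟩ => ⟨x, y, w₁, a₁, s₁, b₁⟩,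
            fun _ => rfl, fun _ => rfl⟩ _ _ fun _ => by simp; ring
      _ = _ := by
        simp only [ih, sum_word_succ, transfer_succ, Finset.mul_sum, Finset.sum_mul, Fin.cons_zero,
          Fin.tail_cons]
        simp only [← Fintype.sum_prod_type']
        exact Fintype.sum_equiv
          ⟨fun ⟨a₁, s₁, b₁, x, w₁, y⟩ => ⟨x, s₁, w₁, y, a₁, b₁⟩,
            fun ⟨x, s₁, w₁, y, a₁, b₁⟩ => ⟨a₁, s₁, b₁, x, w₁, y⟩,
            fun _ => rfl, fun _ => rfl⟩ _ _ fun _ => by simp; ring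

end Transfer

/-! ### Pieces and the Yang-Baxter equation -/

/-- The edge labels of a piece in `H`, listed clockwise from the NW edge of an upward-pointing
piece, or from the North edge of a downward-pointing one. -/
def IsTriple : Label → Label → Label → Bool
  | .zero, .zero, .zero => true
  | .one, .one, .one => true
  | .one, .zero, .ten => true
  | .zero, .ten, .one => true
  | .ten, .one, .zero => true
  | _, _, _ => false

theorem isTriple_rotate (x y z : Label) : IsTriple z x y = IsTriple x y z := by
  revert x y z; decide

/-- The three labels of the piece, in clockwise order, form an admissible triple. -/
def Piece.edgesTriple : Piece → Bool
  | .up x y z => IsTriple x y z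
  | .down x y z => IsTriple x y z

theorem Piece.edgesTriple_rotate (P : Piece) : P.rotate.edgesTriple = P.edgesTriple := by
  cases P with
  | up x y z => rfl
  | down x y z => exact isTriple_rotate x y z

theorem rotate_mem_H {P : Piece} (h : P ∈ H) : P.rotate ∈ H := by
  obtain ⟨B, hB, k, rfl⟩ := h
  exact ⟨B, hB, k + 1, (Function.iterate_succ_apply' _ _ _).symm⟩

theorem mem_H_iff (P : Piece) : P ∈ H ↔ P.edgesTriple = true := by
  constructor
  · rintro ⟨B, hB, k, rfl⟩
    induction k with
    | zero => rcases hB with rfl | rfl | rfl <;> rfl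
    | succ k ih => rwa [Function.iterate_succ_apply', Piece.edgesTriple_rotate]
  · intro h
    have base : ∀ B ∈ basePieces, B ∈ H := fun B hB => ⟨B, hB, 0, rfl⟩
    have h₀ := base (.up .zero .zero .zero) (Or.inl rfl)
    have h₁ := base (.up .one .one .one) (Or.inr (Or.inl rfl))
    have h₂ := base (.up .one .zero .ten) (Or.inr (Or.inr rfl))
    have h₃ := rotate_mem_H (rotate_mem_H h₂)
    have h₄ := rotate_mem_H (rotate_mem_H h₃)
    cases P with
    | up x y z =>
      cases x <;> cases y <;> cases z <;> first | exact Bool.noConfusion h | assumption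
    | down x y z =>
      cases x <;> cases y <;> cases z <;>
        first | exact Bool.noConfusion h | exact rotate_mem_H h₀ | exact rotate_mem_H h₁ |
          exact rotate_mem_H h₂ | exact rotate_mem_H h₃ | exact rotate_mem_H h₄

theorem up_mem_H_iff_down (x y z : Label) : Piece.up x y z ∈ H ↔ Piece.down z x y ∈ H := by
  simp only [mem_H_iff, Piece.edgesTriple, isTriple_rotate x y z]

/-- The rhombus with rising edges `r` (SE), `r'` (NW) and falling edges `f` (SW), `f'` (NE) can be
divided into two pieces of `H` by a horizontal edge `h`. -/
def IsRhombus (r f r' f' : Label) : Prop :=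
  ∃ h, IsTriple r' f' h ∧ IsTriple h r f

instance (r f r' f' : Label) : Decidable (IsRhombus r f r' f') :=
  inferInstanceAs (Decidable (∃ h, IsTriple r' f' h ∧ IsTriple h r f))

/-- The rhombus in which the labels `0` of the rising edges and `1` of the falling edges go straight
through. No horizontal label divides it into pieces of `H`; it is Knutson and Tao's equivariant
piece. -/
def IsCrossing (r f r' f' : Label) : Bool :=
  match r, f, r', f' with
  | .zero, .one, .zero, .one => true
  | _, _, _, _ => false

/-- The pairs of labels with which two rising strands may cross such that each of them keeps its
label. The relation is the strict order of the labels in which `1` comes first and `0` last. -/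
def PassesThrough : Label → Label → Bool
  | .one, .ten => true
  | .one, .zero => true
  | .ten, .zero => true
  | _, _ => false

section Weights

variable {R : Type*} [CommRing R]

/-- The weight of a rhombus at the crossing of a rising strand with a falling strand, for the
parameter `u`. At `u = 0` it is the indicator function of the rhombi made of two pieces of `H`. -/
def rhombusWeight (u : R) (r f r' f' : Label) : R :=
  (if IsRhombus r f r' f' then 1 else 0) - if IsCrossing r f r' f' then u else 0

/-- The weight of the crossing of two strands of the same direction with labels `a`, `b` before and
`a'`, `b'` after the crossing. The strands either exchange their labels, or, if `pass a b` holds,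
keep them at the cost of a factor `u`. -/
def crossWeight {A : Type*} [DecidableEq A] (pass : A → A → Bool) (u : R) (a b a' b' : A) : R :=
  (if a' = b ∧ b' = a then 1 else 0) + if pass a b ∧ a' = a ∧ b' = b then u else 0

theorem crossWeight_symm {A : Type*} [DecidableEq A] (pass : A → A → Bool) (u : R)
    (a b a' b' : A) : crossWeight pass u a' b' a b = crossWeight pass u a b a' b' := by
  unfold crossWeight
  congr 1
  · exact if_congr ⟨fun h => ⟨h.2.symm, h.1.symm⟩, fun h => ⟨h.2.symm, h.1.symm⟩⟩ rfl rfl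
  · refine if_congr ⟨?_, ?_⟩ rfl rfl <;> rintro ⟨h, rfl, rfl⟩ <;> exact ⟨h, rfl, rfl⟩

theorem sum_crossWeight_mul {A : Type*} [DecidableEq A] [Fintype A] (pass : A → A → Bool) (u : R)
    (a b : A) (g : A → A → R) :
    ∑ a₁, ∑ b₁, crossWeight pass u a b a₁ b₁ * g a₁ b₁ =
      g b a + (if pass a b then u else 0) * g a b := by
  simp only [crossWeight, add_mul, Finset.sum_add_distrib, ite_mul, one_mul, zero_mul, ite_and]
  congr 1
  · simp
  · split <;> simp_all

theorem sum_mul_crossWeight {A : Type*} [DecidableEq A] [Fintype A] (pass : A → A → Bool) (u : R)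
    (a b : A) (g : A → A → R) :
    ∑ a₁, ∑ b₁, g a₁ b₁ * crossWeight pass u a₁ b₁ a b =
      g b a + g a b * (if pass a b then u else 0) := by
  simp only [crossWeight_symm pass u a b, mul_comm (g _ _)]
  exact sum_crossWeight_mul pass u a b g

theorem sum_label {M : Type*} [AddCommMonoid M] (f : Label → M) :
    ∑ x, f x = f .zero + (f .one + f .ten) := by
  change (∑ x ∈ ({.zero, .one, .ten} : Finset Label), f x) = _
  simp

/-- The constant coefficient of `rhombusWeight`. -/
def rhombusCount (r f r' f' : Label) : ℤ := if IsRhombus r f r' f' then 1 else 0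
/-- The negative of the linear coefficient of `rhombusWeight`. -/
def crossingCount (r f r' f' : Label) : ℤ := if IsCrossing r f r' f' then 1 else 0
/-- The indicator function of `PassesThrough`. -/
def passCount (a b : Label) : ℤ := if PassesThrough a b then 1 else 0

/-- The coefficient of `u` in the Yang-Baxter equation, after evaluation of the sums over the labels
at the crossing of the two rising strands. -/
theorem yangBaxter_linear : ∀ a b s a₂ b₂ s₂ : Label,
    passCount a b * (∑ s₁, rhombusCount a s a₂ s₁ * rhombusCount b s₁ b₂ s₂) -
        (∑ s₁, crossingCount b s a₂ s₁ * rhombusCount a s₁ b₂ s₂) =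
      passCount a₂ b₂ * (∑ s₁, rhombusCount b s b₂ s₁ * rhombusCount a s₁ a₂ s₂) -
        (∑ s₁, rhombusCount b s a₂ s₁ * crossingCount a s₁ b₂ s₂) := by
  simp only [sum_label]
  decide +kernel

/-- The coefficient of `u ^ 2` in the Yang-Baxter equation. -/
theorem yangBaxter_quadratic : ∀ a b s a₂ b₂ s₂ : Label,
    passCount a b * (∑ s₁, crossingCount a s a₂ s₁ * rhombusCount b s₁ b₂ s₂) =
      passCount a₂ b₂ * (∑ s₁, rhombusCount b s b₂ s₁ * crossingCount a s₁ a₂ s₂) := by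
  simp only [sum_label]
  decide +kernel

theorem rhombusWeight_eq (u : R) (r f r' f' : Label) : rhombusWeight u r f r' f' =
    (rhombusCount r f r' f' : R) - u * (crossingCount r f r' f' : R) := by
  simp [rhombusWeight, rhombusCount, crossingCount]

/-- The Yang-Baxter equation for two rising strands with parameters `u` and `0` and one falling
strand. -/
theorem yangBaxter (u : R) (a b s a₂ b₂ s₂ : Label) :
    ∑ a₁, ∑ b₁, ∑ s₁, crossWeight PassesThrough u a b a₁ b₁ * rhombusWeight u a₁ s a₂ s₁ *
        rhombusWeight 0 b₁ s₁ b₂ s₂ =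
      ∑ a₁, ∑ b₁, ∑ s₁, rhombusWeight 0 b s b₁ s₁ * rhombusWeight u a s₁ a₁ s₂ *
        crossWeight PassesThrough u a₁ b₁ a₂ b₂ := by
  have hk : ∀ x y, (if PassesThrough x y then u else 0) = u * (passCount x y : R) := by
    intro x y; simp [passCount]
  simp only [mul_assoc, ← Finset.mul_sum, sum_crossWeight_mul]
  simp only [← mul_assoc, ← Finset.sum_mul, sum_mul_crossWeight]
  have h₁ := congrArg (Int.cast : ℤ → R) (yangBaxter_linear a b s a₂ b₂ s₂)
  have h₂ := congrArg (Int.cast : ℤ → R) (yangBaxter_quadratic a b s a₂ b₂ s₂)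
  simp only [hk, rhombusWeight_eq, sum_label] at h₁ h₂ ⊢
  push_cast at h₁ h₂
  linear_combination u * h₁ - u ^ 2 * h₂

end Weights

/-! ### Sweeping a line through the parallelogram -/

section Sweep

variable {R : Type*} [CommRing R]

/-- The label prescribed by a binary digit. -/
def binLabel (x : Fin 2) : Label := if x = 1 then .one else .zero

theorem binLabel_ne_ten (x : Fin 2) : binLabel x ≠ .ten := by
  revert x; decide

theorem exists_binLabel {x : Label} (h : x ≠ .ten) : ∃ y, binLabel y = x := by
  revert x; decide

theorem binLabel_injective : Function.Injective binLabel := by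
  unfold Function.Injective; decide

theorem sum_label_eq_sum_bin {M : Type*} [AddCommMonoid M] (f : Label → M) (h : f .ten = 0) :
    ∑ x, f x = ∑ y, f (binLabel y) := by
  simp [sum_label, h, binLabel]

theorem rhombusWeight_one_right (u : R) (a : Label) (x : Fin 2) (f' : Label) :
    rhombusWeight u a (binLabel x) .one f' = if a = .one ∧ f' = binLabel x then 1 else 0 := by
  have h : ∀ a x f', (IsRhombus a (binLabel x) .one f' ↔ a = .one ∧ f' = binLabel x) ∧
      IsCrossing a (binLabel x) .one f' = false := by decide
  simp [rhombusWeight, h]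

theorem rhombusWeight_one_left (u : R) (a : Label) (x : Fin 2) (f : Label) :
    rhombusWeight u .one f a (binLabel x) = if a = .one ∧ f = binLabel x then 1 else 0 := by
  have h : ∀ a x f, (IsRhombus .one f a (binLabel x) ↔ a = .one ∧ f = binLabel x) ∧
      IsCrossing .one f a (binLabel x) = false := by decide
  simp [rhombusWeight, h]

/-- If a rising line ends with label `1` and no falling edge has label `10` before it is crossed,
then the line has label `1` throughout and leaves the falling edges unchanged. -/
theorem transfer_rhombusWeight_one_right (u : R) (n : ℕ) (a : Label) (w : Fin n → Fin 2)
    (f' : Fin n → Label) :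
    transfer (rhombusWeight u) n a (binLabel ∘ w) .one f' =
      if a = .one ∧ f' = binLabel ∘ w then 1 else 0 := by
  induction n generalizing a with
  | zero => simp [transfer_zero, Subsingleton.elim f' (binLabel ∘ w)]
  | succ n ih =>
    have ih' : ∀ x, transfer (rhombusWeight u) n x (Fin.tail (binLabel ∘ w)) .one (Fin.tail f') =
        if x = .one ∧ Fin.tail f' = Fin.tail (binLabel ∘ w) then 1 else 0 :=
      fun x => ih x (Fin.tail w) (Fin.tail f')
    simp only [transfer_succ, ih', Function.comp_apply]
    rw [Finset.sum_eq_single .one (by intro x _ hx; simp [hx]) (by simp),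
      rhombusWeight_one_right]
    have : f' = binLabel ∘ w ↔ f' 0 = binLabel (w 0) ∧ Fin.tail f' = Fin.tail (binLabel ∘ w) := by
      conv_lhs => rw [← Fin.cons_self_tail f', ← Fin.cons_self_tail (binLabel ∘ w)]
      exact Fin.cons_inj
    simp only [this, true_and, ← ite_and, mul_ite, mul_one, mul_zero]
    exact if_congr (by tauto) rfl rfl

/-- If a rising line starts with label `1` and no falling edge has label `10` after it is crossed,
then the line has label `1` throughout and leaves the falling edges unchanged. -/
theorem transfer_rhombusWeight_one_left (u : R) (n : ℕ) (a : Label) (w : Fin n → Fin 2)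
    (f : Fin n → Label) :
    transfer (rhombusWeight u) n .one f a (binLabel ∘ w) =
      if a = .one ∧ f = binLabel ∘ w then 1 else 0 := by
  induction n with
  | zero => simp [transfer_zero, Subsingleton.elim f (binLabel ∘ w), eq_comm]
  | succ n ih =>
    simp only [transfer_succ, Function.comp_apply, rhombusWeight_one_left]
    rw [Finset.sum_eq_single .one (by intro x _ hx; simp [hx]) (by simp)]
    have ih' : transfer (rhombusWeight u) n .one (Fin.tail f) a (Fin.tail (binLabel ∘ w)) =
        if a = .one ∧ Fin.tail f = Fin.tail (binLabel ∘ w) then 1 else 0 :=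
      ih (Fin.tail w) (Fin.tail f)
    rw [ih']
    have : f = binLabel ∘ w ↔ f 0 = binLabel (w 0) ∧ Fin.tail f = Fin.tail (binLabel ∘ w) := by
      conv_lhs => rw [← Fin.cons_self_tail f, ← Fin.cons_self_tail (binLabel ∘ w)]
      exact Fin.cons_inj
    simp only [this, true_and, ← ite_and, mul_ite, mul_one, mul_zero]
    exact if_congr (by tauto) rfl rfl

/-- The weight of a strip of the parallelogram between two successive rows `F`, `F'` of falling
edges, whose rising edges at the right and left ends are labeled `r` and `r'`. It is the number, in
`R`, of ways to fill the strip with pieces of `H`. -/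
def rowWeight (R : Type*) [CommRing R] (a : ℕ) (F : Fin a → Label) (r : Label)
    (F' : Fin a → Label) (r' : Label) : R :=
  transfer (rhombusWeight (0 : R)) a r F r' F'

/-- Sweeping a line with parameter `u` and end labels `1` through the parallelogram. The line
crosses the falling strands below or above the parallelogram, where it has no effect, and the rising
strands to its right or to its left. -/
theorem sweep (u : R) (a c : ℕ) (f f' : Fin a → Fin 2) (d g : Fin c → Label) :
    ∑ w, transfer (crossWeight PassesThrough u) c .one w .one d *
        transfer (rowWeight R a) c (binLabel ∘ f) w (binLabel ∘ f') g =
      ∑ w, transfer (rowWeight R a) c (binLabel ∘ f) d (binLabel ∘ f') w *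
        transfer (crossWeight PassesThrough u) c .one g .one w := by
  have h := transfer_exchange (crossWeight PassesThrough u)
    (fun x F x' F' => transfer (rhombusWeight u) a x F x' F') (rowWeight R a)
    (fun x F s x' F' s' => by
      have h := transfer_intertwine _ _ _ (yangBaxter u) a x x' s s' F F'
      simp only [crossWeight_symm _ _ x' s'] at h
      simpa only [rowWeight, crossWeight_symm _ _ x s] using h)
    c .one .one (binLabel ∘ f) (binLabel ∘ f') d g
  simp only [transfer_rhombusWeight_one_right, transfer_rhombusWeight_one_left] at h
  rw [Finset.sum_eq_single Label.one (by intro x _ hx; simp [hx]) (by simp),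
    Finset.sum_eq_single Label.one (by intro x _ hx; simp [hx]) (by simp)] at h
  simpa using h

/-- `PassesThrough` for binary digits: a `1` passes through a `0`. -/
def binPass (x y : Fin 2) : Bool := PassesThrough (binLabel x) (binLabel y)

theorem transfer_crossWeight_rev {A : Type*} [Fintype A] [DecidableEq A] (pass : A → A → Bool)
    (u : R) (n : ℕ) (a a' : A) (w w' : Fin n → A) :
    transfer (crossWeight pass u) n a (w ∘ Fin.rev) a' (w' ∘ Fin.rev) =
      transfer (crossWeight pass u) n a' w' a w := by
  rw [transfer_rev]
  simp only [crossWeight_symm]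

theorem crossWeight_ne_zero {A : Type*} [DecidableEq A] {pass : A → A → Bool} {u : R}
    {a b a' b' : A} (h : crossWeight pass u a b a' b' ≠ 0) :
    (a' = b ∧ b' = a) ∨ (a' = a ∧ b' = b) := by
  contrapose! h
  rw [crossWeight, if_neg (by tauto), if_neg (by tauto), add_zero]

/-- Crossings conserve labels: no label `10` can occur before if none occurs after. -/
theorem transfer_crossWeight_support {u : R} (n : ℕ) {x y : Label} {w w' : Fin n → Label}
    (h : transfer (crossWeight PassesThrough u) n x w y w' ≠ 0) (hy : y ≠ .ten)
    (hw' : ∀ i, w' i ≠ .ten) : x ≠ .ten ∧ ∀ i, w i ≠ .ten := by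
  induction n generalizing x with
  | zero =>
    rw [transfer_zero] at h
    exact ⟨fun hx => h (if_neg (hx ▸ hy.symm)), fun i => i.elim0⟩
  | succ n ih =>
    rw [transfer_succ] at h
    obtain ⟨z, -, hz⟩ := Finset.exists_ne_zero_of_sum_ne_zero h
    obtain ⟨hz', hw⟩ := ih (right_ne_zero_of_mul hz) fun i => hw' i.succ
    have h₀ := hw' 0
    rcases crossWeight_ne_zero (left_ne_zero_of_mul hz) with ⟨h₁, h₂⟩ | ⟨h₁, h₂⟩
    · exact ⟨h₂ ▸ h₀, Fin.cases (h₁ ▸ hz') hw⟩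
    · exact ⟨h₁ ▸ hz', Fin.cases (h₂ ▸ h₀) hw⟩

theorem transfer_crossWeight_binLabel (u : R) (n : ℕ) (x y : Fin 2) (w w' : Fin n → Fin 2) :
    transfer (crossWeight PassesThrough u) n (binLabel x) (binLabel ∘ w) (binLabel y)
      (binLabel ∘ w') = transfer (crossWeight binPass u) n x w y w' := by
  induction n generalizing x with
  | zero => simp [transfer_zero, binLabel_injective.eq_iff]
  | succ n ih =>
    rw [transfer_succ, transfer_succ, sum_label_eq_sum_bin]
    · refine Finset.sum_congr rfl fun z _ => ?_
      refine congr_arg₂ _ ?_ (ih z (Fin.tail w) (Fin.tail w'))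
      simp only [crossWeight, binPass, Function.comp_apply, binLabel_injective.eq_iff]
      congr
    · refine mul_eq_zero_of_left ?_ _
      by_contra h
      rcases crossWeight_ne_zero h with ⟨h, -⟩ | ⟨h, -⟩ <;> exact binLabel_ne_ten _ h.symm

/-- The generating function of the Pieri operators on binary strings, as a matrix: `pieri u n p q`
is nonzero only if `q` is obtained from `p` by moving each `1` to the left, but not up to or beyond
the old position of the preceding `1`, and then it is a power of `u`, whose exponent is the number
of zeros of `p` minus the total displacement of the ones. -/
def pieri (u : R) (n : ℕ) (p q : Fin n → Fin 2) : R :=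
  transfer (crossWeight binPass u) n 1 p 1 q

theorem pieri_rev (u : R) (n : ℕ) (p q : Fin n → Fin 2) :
    pieri u n (p ∘ Fin.rev) (q ∘ Fin.rev) = pieri u n q p :=
  transfer_crossWeight_rev _ _ _ _ _ _ _

theorem sum_word_label_eq_sum_bin {n : ℕ} (f : (Fin n → Label) → R)
    (h : ∀ w, f w ≠ 0 → ∀ i, w i ≠ .ten) :
    ∑ w, f w = ∑ q : Fin n → Fin 2, f (binLabel ∘ q) := by
  refine (Fintype.sum_of_injective (fun q : Fin n → Fin 2 => binLabel ∘ q)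
    binLabel_injective.comp_left _ _ (fun w hw => ?_) fun _ => rfl).symm
  by_contra h₀
  choose q hq using fun i => exists_binLabel (h w h₀ i)
  exact hw ⟨q, funext hq⟩

/-- The number, in `R`, of fillings of the parallelogram with pieces of `H`. All words are read
upwards: `f` and `f'` label the SW and NE sides, from right to left, and `d` and `g` label the SE
and NW sides, from bottom to top. -/
def partitionSum (R : Type*) [CommRing R] {a c : ℕ} (f f' : Fin a → Fin 2)
    (d g : Fin c → Fin 2) : R :=
  transfer (rowWeight R a) c (binLabel ∘ f) (binLabel ∘ d) (binLabel ∘ f') (binLabel ∘ g)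

/-- The Pieri operator on the SE side has the same effect on the number of fillings as the one on
the NW side. -/
theorem sum_pieri_mul_partitionSum (u : R) {a c : ℕ} (f f' : Fin a → Fin 2)
    (d g : Fin c → Fin 2) :
    ∑ q, pieri u c q d * partitionSum R f f' q g =
      ∑ q, partitionSum R f f' d q * pieri u c g q := by
  have h := sweep u a c f f' (binLabel ∘ d) (binLabel ∘ g)
  rw [sum_word_label_eq_sum_bin, sum_word_label_eq_sum_bin] at h
  · simpa only [pieri, partitionSum, show Label.one = binLabel 1 from rfl,
      transfer_crossWeight_binLabel] using h
  · intro w hw i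
    have h₁ := right_ne_zero_of_mul hw
    rw [← transfer_crossWeight_rev] at h₁
    have := (transfer_crossWeight_support c h₁ (by decide)
      fun i => binLabel_ne_ten _).2 i.rev
    simpa using this
  · intro w hw
    exact (transfer_crossWeight_support c (left_ne_zero_of_mul hw) (by decide)
      fun i => binLabel_ne_ten _).2

/-- The Yang-Baxter equation for three parallel strands with parameters `u`, `v` and `0`, restricted
to the labels `0` and `1`. -/
theorem binYangBaxter (u v : R) (a b s a₂ b₂ s₂ : Fin 2) :
    ∑ a₁, ∑ b₁, ∑ s₁, crossWeight binPass (u - v) a b a₁ b₁ * crossWeight binPass u a₁ s a₂ s₁ *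
        crossWeight binPass v b₁ s₁ b₂ s₂ =
      ∑ a₁, ∑ b₁, ∑ s₁, crossWeight binPass v b s b₁ s₁ * crossWeight binPass u a s₁ a₁ s₂ *
        crossWeight binPass (u - v) a₁ b₁ a₂ b₂ := by
  have h : ∀ x y, binPass x y = (decide (x = 1) && decide (y = 0)) := by decide
  simp only [crossWeight, h, Fin.sum_univ_two]
  fin_cases a <;> fin_cases b <;> fin_cases s <;> fin_cases a₂ <;> fin_cases b₂ <;>
    fin_cases s₂ <;> simp <;> ring

theorem pieri_comm (u v : R) (n : ℕ) (p r : Fin n → Fin 2) :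
    ∑ q, pieri u n p q * pieri v n q r = ∑ q, pieri v n p q * pieri u n q r := by
  have h := transfer_intertwine _ _ _ (binYangBaxter u v) n 1 1 1 1 p r
  simp only [mul_assoc, ← Finset.mul_sum, sum_crossWeight_mul] at h
  simp only [← mul_assoc, ← Finset.sum_mul, sum_mul_crossWeight] at h
  simpa [pieri, show binPass 1 1 = false from rfl] using h

end Sweep

/-! ### Pieri operators and their triangularity -/

theorem eq_zero_or_one (x : Fin 2) : x = 0 ∨ x = 1 := by
  revert x; decide

section Pieri

open Polynomial

/-- The matrix of a single Pieri operator: the coefficient of `u ^ e` in `pieri u n`. -/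
noncomputable def pieriMatrix (e n : ℕ) : Matrix (Fin n → Fin 2) (Fin n → Fin 2) ℤ :=
  fun p q => (pieri (X : ℤ[X]) n p q).coeff e

theorem map_crossWeight {R R' A : Type*} [CommRing R] [CommRing R'] [DecidableEq A] (φ : R →+* R')
    (pass : A → A → Bool) (u : R) (a b a' b' : A) :
    φ (crossWeight pass u a b a' b') = crossWeight pass (φ u) a b a' b' := by
  simp [crossWeight, apply_ite φ]

theorem map_pieri {R R' : Type*} [CommRing R] [CommRing R'] (φ : R →+* R') (u : R) (n : ℕ)
    (p q : Fin n → Fin 2) : φ (pieri u n p q) = pieri (φ u) n p q := by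
  rw [pieri, ← transfer_map]
  simp only [map_crossWeight, pieri]

theorem pieriMatrix_mul_comm (e e' n : ℕ) :
    pieriMatrix e n * pieriMatrix e' n = pieriMatrix e' n * pieriMatrix e n := by
  ext p r
  -- Two independent parameters, so that single coefficients of both factors can be extracted.
  have h := pieri_comm (C X : ℤ[X][X]) X n p r
  have hC : ∀ p q, pieri (C X : ℤ[X][X]) n p q = C (pieri X n p q) :=
    fun p q => (map_pieri C X n p q).symm
  have hX : ∀ p q, pieri (X : ℤ[X][X]) n p q = (pieri (X : ℤ[X]) n p q).map C := by
    intro p q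
    rw [← coe_mapRingHom, map_pieri]
    simp
  replace h := congrArg (fun P : ℤ[X][X] => (P.coeff e').coeff e) h
  simp only [hC, hX, finsetSum_coeff, coeff_C_mul, coeff_mul_C, coeff_map] at h
  simpa only [Matrix.mul_apply, pieriMatrix] using h

/-- The number of ones is conserved. -/
theorem sum_eq_of_transfer_crossWeight_ne_zero {u : ℤ[X]} (n : ℕ) {x y : Fin 2}
    {w w' : Fin n → Fin 2} (h : transfer (crossWeight binPass u) n x w y w' ≠ 0) :
    (x : ℕ) + ∑ i, (w i : ℕ) = y + ∑ i, (w' i : ℕ) := by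
  induction n generalizing x with
  | zero =>
    rw [transfer_zero] at h
    have hxy : x = y := by by_contra hxy; exact h (if_neg hxy)
    simp [hxy]
  | succ n ih =>
    rw [transfer_succ] at h
    obtain ⟨z, -, hz⟩ := Finset.exists_ne_zero_of_sum_ne_zero h
    have h' := ih (right_ne_zero_of_mul hz)
    simp only [Fin.tail] at h'
    rw [Fin.sum_univ_succ, Fin.sum_univ_succ]
    rcases crossWeight_ne_zero (left_ne_zero_of_mul hz) with ⟨h₁, h₂⟩ | ⟨h₁, h₂⟩ <;>
      rw [h₁] at h' <;> rw [h₂] <;> omega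

theorem sum_eq_of_pieriMatrix_ne_zero {e n : ℕ} {p q : Fin n → Fin 2}
    (h : pieriMatrix e n p q ≠ 0) : ∑ i, (p i : ℕ) = ∑ i, (q i : ℕ) := by
  have h' : pieri (X : ℤ[X]) n p q ≠ 0 := fun h₀ => h (by simp [pieriMatrix, h₀])
  exact Nat.add_left_cancel (sum_eq_of_transfer_crossWeight_ne_zero n h')

/-- The generating function `pieri` for a line that starts with label `x` instead of `1`. It is the
state of `pieri` after some sites have been passed. -/
noncomputable def pieriFrom (n : ℕ) (x : Fin 2) (w t : Fin n → Fin 2) : ℤ[X] :=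
  transfer (crossWeight binPass X) n x w 1 t

theorem pieriFrom_cons (n : ℕ) (x y z : Fin 2) (w t : Fin n → Fin 2) :
    pieriFrom (n + 1) x (Fin.cons y w) (Fin.cons z t) =
      (if z = x then pieriFrom n y w t else 0) +
        if x = 1 ∧ y = 0 ∧ z = 0 then X * pieriFrom n 1 w t else 0 := by
  have h : ∀ x y, binPass x y = (decide (x = 1) && decide (y = 0)) := by decide
  simp only [pieriFrom, transfer_succ, Fin.cons_zero, Fin.tail_cons, Fin.sum_univ_two, crossWeight,
    h]
  fin_cases x <;> fin_cases y <;> fin_cases z <;> simp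

/-- In top degree, which is the number of zeros of `t`, nothing moves. -/
theorem exists_top_coeff (n : ℕ) (t : Fin n → Fin 2) :
    ∃ N, (∀ x w m, N < m → (pieriFrom n x w t).coeff m = 0) ∧
      ∀ x w, (pieriFrom n x w t).coeff N = if x = 1 ∧ w = t then 1 else 0 := by
  induction n with
  | zero =>
    refine ⟨0, fun x w m hm => ?_, fun x w => ?_⟩
    · rw [pieriFrom, transfer_zero]
      split
      · rw [coeff_one, if_neg hm.ne']
      · simp
    · rw [pieriFrom, transfer_zero, Subsingleton.elim w t]
      split <;> simp_all
  | succ n ih =>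
    induction t using Fin.consCases with | _ z t =>
    obtain ⟨N, hN, hN'⟩ := ih t
    rcases eq_zero_or_one z with rfl | rfl
    -- A zero of `t` contributes at most one factor `X`, and only if it is passed by a `1`.
    · refine ⟨N + 1, fun x w m hm => ?_, fun x w => ?_⟩
      · induction w using Fin.consCases with | _ y w =>
        obtain ⟨m, rfl⟩ : ∃ k, m = k + 1 := ⟨m - 1, by omega⟩
        have h₁ := hN y w (m + 1) (by omega)
        have h₂ := hN 1 w m (by omega)
        rw [pieriFrom_cons, coeff_add, apply_ite (coeff · _), apply_ite (coeff · _), coeff_X_mul,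
          h₁, h₂]
        simp
      · induction w using Fin.consCases with | _ y w =>
        have h₁ := hN y w (N + 1) (by omega)
        rw [pieriFrom_cons, coeff_add, apply_ite (coeff · _), apply_ite (coeff · _), coeff_X_mul,
          h₁, hN']
        simp only [Fin.cons_inj]
        fin_cases x <;> fin_cases y <;> simp
    · refine ⟨N, fun x w m hm => ?_, fun x w => ?_⟩
      · induction w using Fin.consCases with | _ y w =>
        rw [pieriFrom_cons, coeff_add, apply_ite (coeff · _), hN y w m hm]
        simp
      · induction w using Fin.consCases with | _ y w =>
        rw [pieriFrom_cons, coeff_add, apply_ite (coeff · _), hN']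
        simp only [Fin.cons_inj]
        fin_cases x <;> fin_cases y <;> simp

/-- The rank of a binary string in the lexicographic order in which `1` precedes `0`. -/
def lexRank : (n : ℕ) → (Fin n → Fin 2) → ℕ
  | 0, _ => 0
  | n + 1, w => (if w 0 = 0 then 2 ^ n else 0) + lexRank n (Fin.tail w)

theorem lexRank_cons (n : ℕ) (y : Fin 2) (w : Fin n → Fin 2) :
    lexRank (n + 1) (Fin.cons y w) = (if y = 0 then 2 ^ n else 0) + lexRank n w := rfl

theorem lexRank_lt (n : ℕ) (w : Fin n → Fin 2) : lexRank n w < 2 ^ n := by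
  induction n with
  | zero => simp [lexRank]
  | succ n ih =>
    have := ih (Fin.tail w)
    rw [lexRank, pow_succ]
    split <;> omega

theorem lexRank_one_lt_zero (n : ℕ) (w w' : Fin n → Fin 2) :
    lexRank (n + 1) (Fin.cons 1 w) < lexRank (n + 1) (Fin.cons 0 w') := by
  have := lexRank_lt n w
  simp only [lexRank_cons, one_ne_zero, if_false, if_true]
  omega

/-- The form of `antitone_or_exists_leading` for a string `y :: d` that is not all zeros. If `d'` is
`y :: d` with its first `1` moved to the front, then `t` is `d'` without its first digit, and the
leading term comes from moving this `1` to the right as far as the degree `e` allows. -/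
theorem exists_leading_pieriFrom (n : ℕ) (y : Fin 2) (d : Fin n → Fin 2)
    (h : y = 1 ∨ ∃ i, d i = 1) :
    ∃ t e, (pieriFrom n y d t).coeff e = 1 ∧ ∀ x w, (pieriFrom n x w t).coeff e ≠ 0 →
      (x = y ∧ w = d) ∨
        lexRank (n + 1) (Fin.cons x w) < lexRank (n + 1) (Fin.cons y d) := by
  induction n generalizing y with
  | zero =>
    obtain rfl : y = 1 := h.resolve_right fun ⟨i, _⟩ => i.elim0
    obtain ⟨N, -, hN⟩ := exists_top_coeff 0 d
    refine ⟨d, N, by simp [hN], fun x w hw => Or.inl ?_⟩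
    by_contra h'
    exact hw (by rw [hN, if_neg h'])
  | succ n ih =>
    have hy := eq_zero_or_one y
    rcases hy with rfl | rfl
    · induction d using Fin.consCases with | _ y' d =>
      have h' : y' = 1 ∨ ∃ i, d i = 1 := by
        obtain ⟨i, hi⟩ := h.resolve_left (by decide)
        induction i using Fin.cases with
        | zero => exact Or.inl hi
        | succ i => exact Or.inr ⟨i, hi⟩
      obtain ⟨t, e, he, hlt⟩ := ih y' d h'
      refine ⟨Fin.cons 0 t, e, by simp [pieriFrom_cons, he], fun x w hw => ?_⟩
      have hx := eq_zero_or_one x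
      rcases hx with rfl | rfl
      · induction w using Fin.consCases with | _ x' w =>
        rcases hlt x' w (by simpa [pieriFrom_cons] using hw) with ⟨rfl, rfl⟩ | hlt
        · exact Or.inl ⟨rfl, rfl⟩
        · right
          rw [lexRank_cons (n + 1), lexRank_cons (n + 1)]
          omega
      · exact Or.inr (lexRank_one_lt_zero _ _ _)
    -- In top degree the only preimage of `d` is `d` itself.
    · obtain ⟨N, -, hN⟩ := exists_top_coeff (n + 1) d
      refine ⟨d, N, by simp [hN], fun x w hw => Or.inl ?_⟩
      by_contra h'
      exact hw (by rw [hN, if_neg h'])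

theorem antitone_cons_one {n : ℕ} {w : Fin n → Fin 2} (h : Antitone w) :
    Antitone (Fin.cons 1 w : Fin (n + 1) → Fin 2) := by
  intro i j hij
  induction i using Fin.cases with
  | zero => exact Fin.le_last _
  | succ i =>
    induction j using Fin.cases with
    | zero => exact absurd hij (by simp)
    | succ j => exact h (Fin.succ_le_succ_iff.1 hij)

/-- Every string `d` that is not of the form `1…10…0` is the lexicographically last string in the
image of some earlier string `v` under some Pieri operator, and occurs there with coefficient `1`.
The string `v` arises by moving the first `1` that is preceded by a `0` to the end of the initial
run of ones. -/
theorem antitone_or_exists_leading (n : ℕ) (d : Fin n → Fin 2) :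
    Antitone d ∨ ∃ v e, lexRank n v < lexRank n d ∧ (∀ i : Fin n, (i : ℕ) = 0 → v i = 1) ∧
      pieriMatrix e n d v = 1 ∧
        ∀ w, pieriMatrix e n w v ≠ 0 → w = d ∨ lexRank n w < lexRank n d := by
  induction n with
  | zero => exact Or.inl fun i => i.elim0
  | succ n ih =>
    induction d using Fin.consCases with | _ y d =>
    have hM : ∀ e (x : Fin 2) (w t : Fin n → Fin 2),
        pieriMatrix e (n + 1) (Fin.cons x w) (Fin.cons 1 t) = (pieriFrom n x w t).coeff e := by
      intro e x w t
      change (pieriFrom (n + 1) 1 (Fin.cons x w) (Fin.cons 1 t)).coeff e = _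
      simp [pieriFrom_cons]
    have h0 : ∀ (t : Fin n → Fin 2) (i : Fin (n + 1)), (i : ℕ) = 0 →
        (Fin.cons 1 t : Fin (n + 1) → Fin 2) i = 1 := by
      intro t i hi
      obtain rfl : i = 0 := Fin.ext hi
      rfl
    have hy := eq_zero_or_one y
    rcases hy with rfl | rfl
    · by_cases h : ∃ i, d i = 1
      · right
        obtain ⟨t, e, he, hlt⟩ := exists_leading_pieriFrom n 0 d (Or.inr h)
        refine ⟨Fin.cons 1 t, e, lexRank_one_lt_zero _ _ _, h0 t, by rw [hM, he], fun w hw => ?_⟩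
        induction w using Fin.consCases with | _ x w =>
        rw [hM] at hw
        rcases hlt x w hw with ⟨rfl, rfl⟩ | hlt
        · exact Or.inl rfl
        · exact Or.inr hlt
      · left
        have hd : ∀ i, (Fin.cons 0 d : Fin (n + 1) → Fin 2) i = 0 := by
          intro i
          induction i using Fin.cases with
          | zero => rfl
          | succ i =>
            have h01 : ∀ z : Fin 2, z ≠ 1 → z = 0 := by decide
            exact h01 _ fun hi => h ⟨i, hi⟩
        intro i j _
        rw [hd, hd]
    · rcases ih d with hd | ⟨v, e, hv, hv0, he, hlt⟩
      · exact Or.inl (antitone_cons_one hd)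
      · right
        have hlt' : ∀ w : Fin n → Fin 2, lexRank n w < lexRank n d →
            lexRank (n + 1) (Fin.cons 1 w) < lexRank (n + 1) (Fin.cons 1 d) := by
          intro w hw
          rw [lexRank_cons, lexRank_cons]
          omega
        refine ⟨Fin.cons 1 v, e, hlt' v hv, h0 v, by rw [hM]; exact he, fun w hw => ?_⟩
        induction w using Fin.consCases with | _ x w =>
        rw [hM] at hw
        have hx := eq_zero_or_one x
        rcases hx with rfl | rfl
        -- Since `v` starts with `1`, a line with label `0` cannot leave this `1` behind.
        · refine absurd ?_ hw
          cases n with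
          | zero => simp [lexRank] at hv
          | succ n =>
            induction v using Fin.consCases with | _ z v =>
            induction w using Fin.consCases with | _ x w =>
            obtain rfl : z = 1 := hv0 0 rfl
            simp [pieriFrom_cons]
        · rcases hlt w hw with rfl | h
          · exact Or.inl rfl
          · exact Or.inr (hlt' w h)

theorem eq_of_antitone {n : ℕ} {p q : Fin n → Fin 2} (hp : Antitone p) (hq : Antitone q)
    (h : ∑ i, (p i : ℕ) = ∑ i, (q i : ℕ)) : p = q := by
  have key : ∀ {p q : Fin n → Fin 2}, p ≤ q → ∑ i, (p i : ℕ) = ∑ i, (q i : ℕ) → p = q := by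
    intro p q hpq h
    funext i
    exact Fin.ext ((Finset.sum_eq_sum_iff_of_le fun i _ => Fin.le_def.1 (hpq i)).1 h i
      (Finset.mem_univ i))
  -- Two sorted binary strings are comparable entry by entry.
  by_cases hpq : p ≤ q
  · exact key hpq h
  · refine (key (fun j => ?_) h.symm).symm
    obtain ⟨i, hi⟩ := not_forall.1 hpq
    replace hi : q i < p i := not_le.1 hi
    change q j ≤ p j
    rcases le_total i j with hij | hij
    · have := hp hij; have := hq hij; omega
    · have := hp hij; have := hq hij; omega

/-- Induction over binary strings along the leading terms of the Pieri operators. -/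
theorem pieri_induction {n : ℕ} {P : (Fin n → Fin 2) → Prop} (base : ∀ v, Antitone v → P v)
    (step : ∀ v d e, P v → pieriMatrix e n d v = 1 →
      (∀ w, w ≠ d → pieriMatrix e n w v ≠ 0 → P w) → P d) (d : Fin n → Fin 2) : P d := by
  induction hk : lexRank n d using Nat.strong_induction_on generalizing d with
  | _ k ih =>
    subst hk
    rcases antitone_or_exists_leading n d with hd | ⟨v, e, hv, -, he, hlt⟩
    · exact base d hd
    · exact step v d e (ih _ hv v rfl) he fun w hwd hw =>
        ih _ ((hlt w hw).resolve_left hwd) w rfl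

theorem eq_of_sum_pieriMatrix_eq {n e : ℕ} {v d : Fin n → Fin 2} (f g : (Fin n → Fin 2) → ℤ)
    (he : pieriMatrix e n d v = 1)
    (h : ∀ w, w ≠ d → pieriMatrix e n w v ≠ 0 → f w = g w)
    (hsum : ∑ w, pieriMatrix e n w v * f w = ∑ w, pieriMatrix e n w v * g w) : f d = g d := by
  rw [← sub_eq_zero, ← Finset.sum_sub_distrib, Finset.sum_eq_single d, he] at hsum
  · linarith
  · intro w _ hw
    by_cases h₀ : pieriMatrix e n w v = 0
    · simp [h₀]
    · rw [h w hw h₀, sub_self]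
  · simp

/-- All Pieri operators are self-adjoint for the bilinear form with matrix `F`. -/
def PieriSelfAdjoint {n : ℕ} (F : Matrix (Fin n → Fin 2) (Fin n → Fin 2) ℤ) : Prop :=
  ∀ e, F * pieriMatrix e n = (pieriMatrix e n).transpose * F

theorem PieriSelfAdjoint.sum_eq {n : ℕ} {F : Matrix (Fin n → Fin 2) (Fin n → Fin 2) ℤ}
    (hF : PieriSelfAdjoint F) (e : ℕ) (p q : Fin n → Fin 2) :
    ∑ w, pieriMatrix e n w q * F p w = ∑ w, pieriMatrix e n w p * F w q := by
  have := congrFun (congrFun (hF e) p) q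
  simpa only [Matrix.mul_apply, Matrix.transpose_apply, mul_comm (F _ _)] using this

theorem PieriSelfAdjoint.mul_pieriMatrix {n : ℕ} {F : Matrix (Fin n → Fin 2) (Fin n → Fin 2) ℤ}
    (hF : PieriSelfAdjoint F) (e : ℕ) : PieriSelfAdjoint (F * pieriMatrix e n) := by
  intro e'
  rw [Matrix.mul_assoc, pieriMatrix_mul_comm, ← Matrix.mul_assoc, hF e', Matrix.mul_assoc]

/-- The special case of `PieriSelfAdjoint.apply_comm` where one string is sorted. The induction
replaces `F` by `F * pieriMatrix e n`, so it runs over all forms at once; this is where the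
commutation of the Pieri operators enters. -/
theorem PieriSelfAdjoint.apply_antitone {n : ℕ} {F : Matrix (Fin n → Fin 2) (Fin n → Fin 2) ℤ}
    (hF : PieriSelfAdjoint F) {v d : Fin n → Fin 2} (hv : Antitone v)
    (h : ∑ i, (v i : ℕ) = ∑ i, (d i : ℕ)) : F v d = F d v := by
  induction d using pieri_induction generalizing F with
  | base d hd => rw [eq_of_antitone hv hd h]
  | step d' d e ih he hw =>
    have hd := sum_eq_of_pieriMatrix_ne_zero (e := e) (p := d) (q := d') (by simp [he])
    refine eq_of_sum_pieriMatrix_eq (fun w => F v w) (fun w => F w v) he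
      (fun w hwd hw₀ => hw w hwd hw₀ hF ?_) ?_
    · rw [h, hd, sum_eq_of_pieriMatrix_ne_zero hw₀]
    · have h₁ := ih (hF.mul_pieriMatrix e) (h.trans hd)
      have h₂ : (F * pieriMatrix e n) d' v = ∑ w, pieriMatrix e n w d' * F w v := by
        rw [hF e]; rfl
      rw [h₂, Matrix.mul_apply] at h₁
      simpa only [mul_comm (F _ _)] using h₁

/-- A bilinear form for which all Pieri operators are self-adjoint is symmetric on strings with the
same number of ones. -/
theorem PieriSelfAdjoint.apply_comm {n : ℕ} {F : Matrix (Fin n → Fin 2) (Fin n → Fin 2) ℤ}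
    (hF : PieriSelfAdjoint F) {p q : Fin n → Fin 2}
    (h : ∑ i, (p i : ℕ) = ∑ i, (q i : ℕ)) : F p q = F q p := by
  induction p using pieri_induction generalizing q with
  | base p hp => exact hF.apply_antitone hp h
  | step v p e ih he hw =>
    have hp := sum_eq_of_pieriMatrix_ne_zero (e := e) (p := p) (q := v) (by simp [he])
    refine eq_of_sum_pieriMatrix_eq (fun w => F w q) (fun w => F q w) he
      (fun w hwd hw₀ => hw w hwd hw₀ ?_) ?_
    · rw [← h, hp, sum_eq_of_pieriMatrix_ne_zero hw₀]
    · rw [← hF.sum_eq e v q, hF.sum_eq e q v]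
      refine Finset.sum_congr rfl fun w _ => ?_
      by_cases h₀ : pieriMatrix e n w q = 0
      · simp [h₀]
      · rw [ih (by rw [← hp, h, sum_eq_of_pieriMatrix_ne_zero h₀])]

end Pieri

/-! ### Symmetry of the partition sum -/

open Polynomial in
theorem C_partitionSum {a c : ℕ} (f f' : Fin a → Fin 2) (d g : Fin c → Fin 2) :
    partitionSum ℤ[X] f f' d g = C (partitionSum ℤ f f' d g) := by
  have h₀ : ∀ r f r' f', rhombusWeight (0 : ℤ[X]) r f r' f' = C (rhombusWeight 0 r f r' f') := by
    intro r f r' f'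
    simp [rhombusWeight, apply_ite (C : ℤ →+* ℤ[X])]
  have h₁ : ∀ F r F' r', rowWeight ℤ[X] a F r F' r' = C (rowWeight ℤ a F r F' r') := by
    intro F r F' r'
    rw [rowWeight, rowWeight, ← transfer_map]
    simp only [← h₀]
  rw [partitionSum, partitionSum, ← transfer_map]
  simp only [← h₁]

/-- Reading one of the two words backwards turns the commutation with the Pieri operators into
self-adjointness, since reversal of strings transposes `pieri`. -/
theorem pieriSelfAdjoint_partitionSum {a c : ℕ} (f f' : Fin a → Fin 2) :
    PieriSelfAdjoint
      (Matrix.of fun g d : Fin c → Fin 2 => partitionSum ℤ f f' d (g ∘ Fin.rev)) := by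
  intro e
  ext g d
  have h := sum_pieri_mul_partitionSum (Polynomial.X : Polynomial ℤ) f f' d (g ∘ Fin.rev)
  rw [← Equiv.sum_comp (Equiv.arrowCongr Fin.revPerm (Equiv.refl (Fin 2)))
    fun q => partitionSum _ f f' d q * pieri _ c (g ∘ Fin.rev) q] at h
  replace h := congrArg (fun P => Polynomial.coeff P e) h
  have hrev : ∀ q : Fin c → Fin 2,
      Equiv.arrowCongr Fin.revPerm (Equiv.refl (Fin 2)) q = q ∘ Fin.rev := fun q => rfl
  simp only [hrev, pieri_rev, C_partitionSum, Polynomial.finsetSum_coeff,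
    Polynomial.coeff_C_mul, Polynomial.coeff_mul_C] at h
  rw [Matrix.mul_apply, Matrix.mul_apply]
  simp only [Matrix.transpose_apply, Matrix.of_apply, pieriMatrix]
  simpa only [mul_comm] using h

theorem partitionSum_swap {a c : ℕ} (f f' : Fin a → Fin 2) (d g : Fin c → Fin 2)
    (h : ∑ i, (d i : ℕ) = ∑ i, (g i : ℕ)) :
    partitionSum ℤ f f' (d ∘ Fin.rev) g = partitionSum ℤ f f' (g ∘ Fin.rev) d := by
  have hrev : ∀ w : Fin c → Fin 2, ∑ i, ((w ∘ Fin.rev) i : ℕ) = ∑ i, (w i : ℕ) :=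
    fun w => Equiv.sum_comp Fin.revPerm fun i => (w i : ℕ)
  have := (pieriSelfAdjoint_partitionSum f f').apply_comm (p := g ∘ Fin.rev) (q := d ∘ Fin.rev)
    (by rw [hrev, hrev, h])
  simpa [Function.comp_assoc, Fin.rev_involutive.comp_self] using this

/-! ### Puzzles and the partition sum -/

/-- The labels of the falling and rising edges come from a puzzle with boundary words `f`, `f'`,
`d`, `g`, read as in `partitionSum`. -/
def IsFilling {a c : ℕ} (f f' : Fin a → Label) (d g : Fin c → Label)
    (falling : Fin (c + 1) → Fin a → Label) (rising : Fin c → Fin (a + 1) → Label) : Prop :=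
  (falling 0 = f ∧ falling (Fin.last c) = f') ∧
    ∀ i, (rising i 0 = d i ∧ rising i (Fin.last a) = g i) ∧
      ∀ j, IsRhombus (rising i j.castSucc) (falling i.castSucc j) (rising i j.succ)
        (falling i.succ j)

open Classical in
theorem partitionSum_eq_card {a c : ℕ} (f f' : Fin a → Fin 2) (d g : Fin c → Fin 2) :
    partitionSum ℤ f f' d g =
      Nat.card {x : (Fin (c + 1) → Fin a → Label) × (Fin c → Fin (a + 1) → Label) //
        IsFilling (binLabel ∘ f) (binLabel ∘ f') (binLabel ∘ d) (binLabel ∘ g) x.1 x.2} := by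
  have hW : ∀ r x r' x', rhombusWeight (0 : ℤ) r x r' x' =
      if IsRhombus r x r' x' then 1 else 0 := by
    intro r x r' x'
    simp [rhombusWeight]
  rw [Nat.card_eq_fintype_card, Fintype.card_subtype, ← Finset.sum_boole, Fintype.sum_prod_type,
    partitionSum, transfer_eq_sum_path]
  refine Finset.sum_congr rfl fun falling _ => ?_
  simp only [rowWeight, transfer_eq_sum_path, hW, Finset.prod_ite_zero, Finset.prod_const_one,
    Finset.prod_univ_sum, Fintype.piFinset_univ, ← ite_and, Finset.mem_univ, true_imp_iff]
  split_ifs with h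
  · refine Finset.sum_congr rfl fun rising _ => if_congr ?_ rfl rfl
    exact ⟨fun h' => ⟨h, h'⟩, fun h' => h'.2⟩
  · exact (Finset.sum_eq_zero fun rising _ => if_neg fun h' => h h'.1).symm

theorem isTriple_left_unique : ∀ {h h' r f : Label}, IsTriple h r f → IsTriple h' r f → h = h' := by
  decide

theorem numPuzzles_eq_partitionSum {a a₁ c c₁ : ℕ} (α β : BinString a a₁) (γ δ : BinString c c₁) :
    (numPuzzles α γ β δ : ℤ) = partitionSum ℤ α.1 (β.1 ∘ Fin.rev) (δ.1 ∘ Fin.rev) γ.1 := by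
  rw [partitionSum_eq_card, numPuzzles]
  congr 1
  refine Nat.card_congr (Equiv.ofBijective (fun P => ⟨(P.falling, P.rising), ?_⟩) ⟨?_, ?_⟩)
  · refine ⟨⟨funext P.sw, funext fun j => ?_⟩, fun i => ⟨⟨?_, P.nw i⟩, fun j =>
      ⟨P.horizontal i j, (mem_H_iff _).1 (P.up_mem i j), (mem_H_iff _).1 (P.down_mem i j)⟩⟩⟩
    · simpa [BinString.label, binLabel] using P.ne j.rev
    · simpa [BinString.label, binLabel] using P.se i.rev
  · intro P Q hPQ
    obtain ⟨hf, hr⟩ := Prod.mk.inj (Subtype.mk.inj hPQ)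
    refine ParPuzzle.ext hr hf (funext₂ fun i j => ?_)
    have h₁ := (mem_H_iff _).1 (P.down_mem i j)
    have h₂ := (mem_H_iff _).1 (Q.down_mem i j)
    rw [hf, hr] at h₁
    exact isTriple_left_unique h₁ h₂
  · rintro ⟨⟨falling, rising⟩, ⟨h₀, h₁⟩, h⟩
    choose horizontal hup hdown using fun i => (h i).2
    exact ⟨{
      rising := rising
      falling := falling
      horizontal := horizontal
      up_mem := fun i j => (mem_H_iff _).2 (hup i j)
      down_mem := fun i j => (mem_H_iff _).2 (hdown i j)
      sw := congrFun h₀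
      nw := fun i => (h i).1.2
      ne := fun j => by simpa [BinString.label, binLabel] using congrFun h₁ j.rev
      se := fun i => by simpa [BinString.label, binLabel] using (h i.rev).1.1 }, rfl⟩

theorem BinString.sum_val {n k : ℕ} (s : BinString n k) : ∑ i, (s.1 i : ℕ) = k := by
  have h : ∀ x : Fin 2, (x : ℕ) = if x = 1 then 1 else 0 := by decide
  refine Eq.trans ?_ s.2
  rw [Finset.card_filter]
  exact Finset.sum_congr rfl fun i _ => h _

theorem numPuzzles_swap {a a₁ c c₁ : ℕ} (α β : BinString a a₁) (γ δ : BinString c c₁) :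
    numPuzzles α γ β δ = numPuzzles α δ β γ := by
  have h := partitionSum_swap α.1 (β.1 ∘ Fin.rev) δ.1 γ.1 (by rw [δ.sum_val, γ.sum_val])
  rw [← numPuzzles_eq_partitionSum, ← numPuzzles_eq_partitionSum] at h
  exact_mod_cast h

/-- Rotation of a puzzle by 180 degrees. -/
def ParPuzzle.rotate {a a₁ c c₁ : ℕ} {α β : BinString a a₁} {γ δ : BinString c c₁}
    (P : ParPuzzle α γ β δ) : ParPuzzle β δ α γ where
  rising i j := P.rising i.rev j.rev
  falling i j := P.falling i.rev j.rev
  horizontal i j := P.horizontal i.rev j.rev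
  up_mem i j := by
    rw [up_mem_H_iff_down, Fin.rev_succ, Fin.rev_succ]
    exact P.down_mem i.rev j.rev
  down_mem i j := by
    rw [← up_mem_H_iff_down, Fin.rev_castSucc, Fin.rev_castSucc]
    exact P.up_mem i.rev j.rev
  sw j := by simpa using P.ne j
  nw i := by simpa using P.se i
  ne j := by simpa using P.sw j
  se i := by simpa using P.nw i

theorem ParPuzzle.rotate_rotate {a a₁ c c₁ : ℕ} {α β : BinString a a₁} {γ δ : BinString c c₁}
    (P : ParPuzzle α γ β δ) : P.rotate.rotate = P := by
  ext <;> simp [ParPuzzle.rotate]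

theorem numPuzzles_rotate {a a₁ c c₁ : ℕ} (α β : BinString a a₁) (γ δ : BinString c c₁) :
    numPuzzles α γ β δ = numPuzzles β δ α γ :=
  Nat.card_congr ⟨ParPuzzle.rotate, ParPuzzle.rotate, ParPuzzle.rotate_rotate,
    ParPuzzle.rotate_rotate⟩

end Puzzle

theorem theorem4 (a a₁ c c₁ : ℕ) (α β : Puzzle.BinString a a₁) (γ δ : Puzzle.BinString c c₁) :
    Puzzle.numPuzzles α γ β δ = Puzzle.numPuzzles β γ α δ ∧
    Puzzle.numPuzzles β γ α δ = Puzzle.numPuzzles α δ β γ ∧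
    Puzzle.numPuzzles α δ β γ = Puzzle.numPuzzles β δ α γ := by
  refine ⟨?_, Puzzle.numPuzzles_rotate _ _ _ _, ?_⟩
  · rw [Puzzle.numPuzzles_rotate β α, Puzzle.numPuzzles_swap]
  · rw [Puzzle.numPuzzles_swap, Puzzle.numPuzzles_rotate]
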